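/- **Theorem 2.7 (Kalman Controllability Rank Condition).** Let $\mathbb{T}\subseteq\mathbb{R}$ be a time scale (a nonempty closed set) that is unbounded above and has bounded graininess $\mu(t)=\sigma(t)-t$, where $\sigma(t)=\inf\{s\in\mathbb{T}: s>t\}$. Let $A\in\mathbb{R}^{n\times n}$, $B\in\mathbb{R}^{n\times m}$, $C\in\mathbb{R}^{p\times n}$, $D\in\mathbb{R}^{p\times m}$ be constant matrices such that the system is regressive, i.e. $I+\mu(t)A$ is invertible for all $t\in\mathbb{T}$, and let $t_0\le t_f$ be points of $\mathbb{T}$. The time invariant system $$x^{\Delta}(t)=Ax(t)+Bu(t),\quad x(t_0)=x_0,\qquad y(t)=Cx(t)+Du(t),\qquad t\in\mathbb{T},$$ where $x^\Delta$ is the delta derivative, is called controllable on $[t_0,t_f]$ if for all $x_0,x_f\in\mathbb{R}^n$ there is an input $u:\mathbb{T}\to\mathbb{R}^m$ that is rd-continuous (continuous at right-dense points, with finite left-sided limits at left-dense points) such that the corresponding solution satisfies $x(t_f)=x_f$. If $[t_0,t_f)\cap\mathbb{T}$ has at least $n$ points (possibly infinitely many), then the system is controllable on $[t_0,t_f]$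 if and only if the $n\times nm$ matrix $[\,B\ \ AB\ \cdots\ A^{n-1}B\,]$ has rank $n$. The implication from controllability on $[t_0,t_f]$ to rank $n$ holds without the assumption on the number of points of $[t_0,t_f)\cap\mathbb{T}$. -/

import Mathlib

open Set Filter Topology

/-- A time scale is a nonempty closed subset of the real line. -/
def IsTimeScale (T : Set ℝ) : Prop :=
  T.Nonempty ∧ IsClosed T

namespace TimeScale

/-- Forward jump operator `σ(t) = inf {s ∈ T | s > t}`, with `σ(t) = t` if there is no such `s`. -/
noncomputable def forwardJump (T : Set ℝ) (t : ℝ) : ℝ :=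
  open Classical in if (T ∩ Ioi t).Nonempty then sInf (T ∩ Ioi t) else t

/-- Backward jump operator `ρ(t) = sup {s ∈ T | s < t}`, with `ρ(t) = t` if there is no such `s`. -/
noncomputable def backwardJump (T : Set ℝ) (t : ℝ) : ℝ :=
  open Classical in if (T ∩ Iio t).Nonempty then sSup (T ∩ Iio t) else t

/-- The graininess `μ(t) = σ(t) - t`. -/
noncomputable def graininess (T : Set ℝ) (t : ℝ) : ℝ :=
  forwardJump T t - t

/-- The graininess is bounded on the time scale. -/
def HasBoundedGraininess (T : Set ℝ) : Prop :=
  ∃ M : ℝ, ∀ t ∈ T, graininess T t ≤ M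

/-- The set `T^κ`: the time scale without its maximum, if it has one that is left-scattered. -/
def kappa (T : Set ℝ) : Set ℝ :=
  {t ∈ T | ¬ (IsGreatest T t ∧ backwardJump T t < t)}

/-- `t` is right-dense: `t` is not the maximum and `σ(t) = t`. -/
def RightDense (T : Set ℝ) (t : ℝ) : Prop :=
  (T ∩ Ioi t).Nonempty ∧ forwardJump T t = t

/-- `t` is left-dense: `t` is not the minimum and `ρ(t) = t`. -/
def LeftDense (T : Set ℝ) (t : ℝ) : Prop :=
  (T ∩ Iio t).Nonempty ∧ backwardJump T t = t

/- Functions on a time scale are written as functions on `ℝ`; only their values on `T` are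
ever used. -/

/-- Rd-continuity on `T`: continuity at the right-dense points, and existence of finite left-sided
limits at the left-dense points. -/
def RdContinuous {E : Type*} [TopologicalSpace E] (T : Set ℝ) (f : ℝ → E) : Prop :=
  (∀ t ∈ T, RightDense T t → ContinuousWithinAt f T t) ∧
  (∀ t ∈ T, LeftDense T t → ∃ l : E, Tendsto f (𝓝[T ∩ Iio t] t) (𝓝 l))

/-- `f` has delta derivative `f'` at `t`: for every `ε > 0`, all `s ∈ T` close enough to `t`
satisfy `‖f(σ(t)) - f(s) - (σ(t) - s) f'‖ ≤ ε |σ(t) - s|`. -/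
def HasDeltaDerivAt {E : Type*} [NormedAddCommGroup E] [NormedSpace ℝ E]
    (T : Set ℝ) (f : ℝ → E) (f' : E) (t : ℝ) : Prop :=
  ∀ ε : ℝ, 0 < ε → ∀ᶠ s in 𝓝[T] t,
    ‖f (forwardJump T t) - f s - (forwardJump T t - s) • f'‖ ≤ ε * |forwardJump T t - s|

/-- The coefficients of a linear system `x^Δ = A x + B u`, `y = C x + D u` with `n` states,
`m` inputs and `p` outputs. -/
structure LinearSystem (n m p : ℕ) where
  A : ℝ → Matrix (Fin n) (Fin n) ℝ
  B : ℝ → Matrix (Fin n) (Fin m) ℝ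
  C : ℝ → Matrix (Fin p) (Fin n) ℝ
  D : ℝ → Matrix (Fin p) (Fin m) ℝ

namespace LinearSystem

variable {n m p : ℕ}

/-- The time invariant system with the given constant coefficients. -/
def timeInvariant (A : Matrix (Fin n) (Fin n) ℝ) (B : Matrix (Fin n) (Fin m) ℝ)
    (C : Matrix (Fin p) (Fin n) ℝ) (D : Matrix (Fin p) (Fin m) ℝ) : LinearSystem n m p where
  A := fun _ => A
  B := fun _ => B
  C := fun _ => C
  D := fun _ => D

/-- The system is regressive on `T`: `I + μ(t) A(t)` is invertible for every `t ∈ T^κ`. -/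
def IsRegressive (T : Set ℝ) (S : LinearSystem n m p) : Prop :=
  ∀ t ∈ kappa T, IsUnit (1 + graininess T t • S.A t)

/-- `x` and `y` are the state and the output of the system on `T`, for the input `u` and the
initial condition `x(t₀) = x₀`. -/
structure IsSolution (T : Set ℝ) (S : LinearSystem n m p) (u : ℝ → Fin m → ℝ)
    (t₀ : ℝ) (x₀ : Fin n → ℝ) (x : ℝ → Fin n → ℝ) (y : ℝ → Fin p → ℝ) : Prop where
  dynamics : ∀ t ∈ kappa T,
    HasDeltaDerivAt T x (Matrix.mulVec (S.A t) (x t) + Matrix.mulVec (S.B t) (u t)) t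
  initial : x t₀ = x₀
  output : ∀ t ∈ T, y t = Matrix.mulVec (S.C t) (x t) + Matrix.mulVec (S.D t) (u t)

/-- Controllability on `[t₀, t_f]`: every initial state can be steered to every final state by an
rd-continuous input. -/
def IsControllableOn (T : Set ℝ) (S : LinearSystem n m p) (t₀ t_f : ℝ) : Prop :=
  ∀ x₀ x_f : Fin n → ℝ, ∃ u : ℝ → Fin m → ℝ, RdContinuous T u ∧
    ∃ (x : ℝ → Fin n → ℝ) (y : ℝ → Fin p → ℝ), IsSolution T S u t₀ x₀ x y ∧ x t_f = x_f

end LinearSystem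

/-- The `n × nm` controllability matrix `[B  AB  ⋯  A^{n-1}B]`; the column `(k, j)` is column `j`
of the block `A^k B`. -/
def controllabilityMatrix {n m : ℕ} (A : Matrix (Fin n) (Fin n) ℝ)
    (B : Matrix (Fin n) (Fin m) ℝ) : Matrix (Fin n) (Fin n × Fin m) ℝ :=
  Matrix.of fun i kj => (A ^ (kj.1 : ℕ) * B) i kj.2

end TimeScale

namespace TimeScale

/-! ### Jump operators, induction along a time scale, rd-continuity -/

section Jump

variable {T : Set ℝ}

/-! Necessity. By Cayley–Hamilton the column space `W` of the controllability matrix is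
`A`-invariant, and it contains the range of `B`. A projection `P` with kernel `W` therefore removes
the input: for a trajectory from `0`, `z = P x` solves `z^Δ = P A z` with `z(t₀) = 0`. Uniqueness
(`eq_zero_of_hasDeltaDerivAt_clm`, a Grönwall argument by induction along `T`) gives `z = 0`, so
every reachable state lies in `W`.

Sufficiency. Regressivity yields an invertible fundamental solution `Φ`
(`exists_fundamental_solution`), and `M = Φ⁻¹` satisfies `M^Δ = -M^σ A`. With the Gramian `G = ∫ M^σ
B (M^σ B)ᵀ Δs`, the input `(M^σ B)ᵀ φ` leads from `x₀` to `Φ(t_f)(x₀ + G φ)`, so it is enough that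
`G` be injective. If `G φ = 0`, then `φᵀ M^σ B = 0` on `[t₀, t_f)`. Each delta differentiation
brings in one more factor `A` and costs one jump at the left end, so `φᵀ M A^k B = 0` on `(σ^k(t₀),
t_f]` (`vecMul_eq_zero_of_adjoint`). Having `n` points in `[t₀, t_f)` means `σ^k(t₀) < t_f` for all
`k < n`; at `t_f` the rank condition then forces `φᵀ M(t_f) = 0`, hence `φ = 0`.

Delta integrals are realized as Lebesgue integrals of the step extension `r ↦ f (lastPoint T r)`. -/

theorem nonempty_inter_Ioi (hu : ¬ BddAbove T) (t : ℝ) : (T ∩ Ioi t).Nonempty := by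
  obtain ⟨s, hs, hts⟩ := not_bddAbove_iff.1 hu t
  exact ⟨s, hs, hts⟩

theorem forwardJump_eq (hu : ¬ BddAbove T) (t : ℝ) : forwardJump T t = sInf (T ∩ Ioi t) := by
  rw [forwardJump, if_pos (nonempty_inter_Ioi hu t)]

theorem le_forwardJump (hu : ¬ BddAbove T) (t : ℝ) : t ≤ forwardJump T t := by
  rw [forwardJump_eq hu]
  exact le_csInf (nonempty_inter_Ioi hu t) fun s hs => le_of_lt hs.2

theorem forwardJump_le (hu : ¬ BddAbove T) {t s : ℝ} (hs : s ∈ T) (hts : t < s) :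
    forwardJump T t ≤ s := by
  rw [forwardJump_eq hu]
  exact csInf_le ⟨t, fun r hr => le_of_lt hr.2⟩ ⟨hs, hts⟩

theorem forwardJump_mem (hc : IsClosed T) (hu : ¬ BddAbove T) (t : ℝ) : forwardJump T t ∈ T := by
  have h : sInf (T ∩ Ioi t) ∈ closure (T ∩ Ioi t) :=
    csInf_mem_closure (nonempty_inter_Ioi hu t) ⟨t, fun r hr => le_of_lt hr.2⟩
  rw [forwardJump_eq hu]
  exact hc.closure_subset (closure_mono inter_subset_left h)

theorem forwardJump_mono (hu : ¬ BddAbove T) : Monotone (forwardJump T) := by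
  intro a b hab
  rw [forwardJump_eq hu, forwardJump_eq hu]
  exact csInf_le_csInf ⟨a, fun r hr => le_of_lt hr.2⟩ (nonempty_inter_Ioi hu b)
    fun r hr => ⟨hr.1, lt_of_le_of_lt hab hr.2⟩

theorem exists_mem_Ioo_of_forwardJump_eq (hu : ¬ BddAbove T) {t b : ℝ} (h : forwardJump T t = t)
    (hb : t < b) : ∃ s ∈ T, t < s ∧ s < b := by
  rw [forwardJump_eq hu] at h
  obtain ⟨s, hs, hsb⟩ := exists_lt_of_csInf_lt (nonempty_inter_Ioi hu t) (h.trans_lt hb)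
  exact ⟨s, hs.1, hs.2, hsb⟩

theorem forwardJump_inter_Ici {a t : ℝ} (hat : a ≤ t) :
    forwardJump (T ∩ Ici a) t = forwardJump T t := by
  have h : T ∩ Ici a ∩ Ioi t = T ∩ Ioi t := by
    ext s
    simp only [mem_inter_iff, mem_Ici, mem_Ioi]
    constructor
    · rintro ⟨⟨h1, -⟩, h2⟩
      exact ⟨h1, h2⟩
    · rintro ⟨h1, h2⟩
      exact ⟨⟨h1, hat.trans h2.le⟩, h2⟩
  unfold forwardJump
  rw [h]

theorem not_bddAbove_inter_Ici (hu : ¬ BddAbove T) (a : ℝ) : ¬ BddAbove (T ∩ Ici a) := by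
  rw [not_bddAbove_iff]
  intro x
  obtain ⟨s, hs, hxs⟩ := not_bddAbove_iff.1 hu (max x a)
  exact ⟨s, ⟨hs, (le_max_right x a).trans hxs.le⟩, (le_max_left x a).trans_lt hxs⟩

/-- A point of a time scale that is not its minimum is either the forward jump of an earlier point
or an accumulation point from the left. -/
theorem eq_forwardJump_or_mem_closure (hc : IsClosed T) (hu : ¬ BddAbove T) {s : ℝ} (hs : s ∈ T)
    (h : (T ∩ Iio s).Nonempty) :
    (∃ r ∈ T, r < s ∧ forwardJump T r = s) ∨ s ∈ closure (T ∩ Iio s) := by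
  have hbdd : BddAbove (T ∩ Iio s) := ⟨s, fun r hr => le_of_lt hr.2⟩
  have hmem := csSup_mem_closure h hbdd
  have hle : sSup (T ∩ Iio s) ≤ s := csSup_le h fun r hr => le_of_lt hr.2
  rcases hle.eq_or_lt with heq | hlt
  · right
    rwa [heq] at hmem
  · left
    refine ⟨_, hc.closure_subset (closure_mono inter_subset_left hmem), hlt,
      le_antisymm (forwardJump_le hu hs hlt) ?_⟩
    -- Otherwise the supremum would be right-dense, and points of `T` would lie strictly between it
    -- and `s`.
    by_contra hcon
    push Not at hcon
    have h1 : forwardJump T (sSup (T ∩ Iio s)) ≤ sSup (T ∩ Iio s) :=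
      le_csSup hbdd ⟨forwardJump_mem hc hu _, hcon⟩
    obtain ⟨r, hr, hr1, hr2⟩ := exists_mem_Ioo_of_forwardJump_eq hu
      (le_antisymm h1 (le_forwardJump hu _)) hlt
    exact absurd (le_csSup hbdd ⟨hr, hr2⟩) (not_le.2 hr1)

/-- Induction along a time scale, from `a` upwards. -/
theorem induction_Ici (hc : IsClosed T) (hu : ¬ BddAbove T) {a : ℝ} (ha : a ∈ T) {P : ℝ → Prop}
    (base : P a)
    (jump : ∀ t ∈ T, a ≤ t → t < forwardJump T t → P t → P (forwardJump T t))
    (right : ∀ t ∈ T, a ≤ t → forwardJump T t = t → P t → ∀ᶠ s in 𝓝[T ∩ Ioi t] t, P s)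
    (left : ∀ t ∈ T, a < t → t ∈ closure (T ∩ Iio t) → (∀ s ∈ T, a ≤ s → s < t → P s) → P t) :
    ∀ t ∈ T, a ≤ t → P t := by
  by_contra hcon
  push Not at hcon
  obtain ⟨b, hb, hab, hPb⟩ := hcon
  set S : Set ℝ := {s | s ∈ T ∧ a ≤ s ∧ ¬ P s} with hS
  have hne : S.Nonempty := ⟨b, hb, hab, hPb⟩
  have hbdd : BddBelow S := ⟨a, fun s hs => hs.2.1⟩
  set m := sInf S with hm
  have hmT : m ∈ T :=
    hc.closure_subset (closure_mono (fun s hs => hs.1) (csInf_mem_closure hne hbdd))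
  have ham : a ≤ m := le_csInf hne fun s hs => hs.2.1
  have hbelow : ∀ s ∈ T, a ≤ s → s < m → P s := by
    intro s hs has hsm
    by_contra hP
    exact absurd (csInf_le hbdd ⟨hs, has, hP⟩) (not_le.2 hsm)
  -- The infimum `m` of the counterexamples is itself good, and the counterexamples stay away from
  -- it on the right; this contradicts its being their infimum.
  have hPm : P m := by
    rcases ham.eq_or_lt with h | h
    · rwa [← h]
    · rcases eq_forwardJump_or_mem_closure hc hu hmT ⟨a, ha, h⟩ with ⟨r, hr, hrm, hj⟩ | hcl
      · have har : a ≤ r := by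
          by_contra h'
          push Not at h'
          exact absurd (forwardJump_le hu ha h') (not_le.2 (hj ▸ h))
        rw [← hj]
        exact jump r hr har (hj.symm ▸ hrm) (hbelow r hr har hrm)
      · exact left m hmT h hcl hbelow
  have hlt : ∀ s ∈ S, m < s := by
    intro s hs
    refine lt_of_le_of_ne (csInf_le hbdd hs) ?_
    rintro rfl
    exact hs.2.2 hPm
  have key : ∃ c, m < c ∧ ∀ s ∈ S, c ≤ s := by
    rcases (le_forwardJump hu m).eq_or_lt with h | h
    · obtain ⟨c, hmc, hcP⟩ : ∃ c, m < c ∧ ∀ s ∈ T, m < s → s < c → P s := by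
        have h1 := right m hmT ham h.symm hPm
        rw [eventually_nhdsWithin_iff, Metric.eventually_nhds_iff] at h1
        obtain ⟨ε, hε, h2⟩ := h1
        refine ⟨m + ε, by linarith, fun s hs hms hsε => h2 ?_ ⟨hs, hms⟩⟩
        rw [Real.dist_eq, abs_lt]
        constructor <;> linarith
      refine ⟨c, hmc, fun s hs => ?_⟩
      by_contra h'
      push Not at h'
      exact hs.2.2 (hcP s hs.1 (hlt s hs) h')
    · exact ⟨_, h, fun s hs => forwardJump_le hu hs.1 (hlt s hs)⟩
  obtain ⟨c, hmc, hcS⟩ := key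
  exact absurd (le_csInf hne hcS) (not_le.2 hmc)

/-- One jump leaves behind at most one point of `T ∩ Ico a b`. This turns the hypothesis on the
number of points into a bound on iterated jumps. -/
theorem iterate_forwardJump_lt (hu : ¬ BddAbove T) {b : ℝ} (k : ℕ) :
    ∀ a : ℝ, ((k : ℕ∞) < (T ∩ Ico a b).encard) → (forwardJump T)^[k] a < b := by
  induction k with
  | zero =>
    intro a h
    obtain ⟨s, -, hs⟩ := encard_pos.1 (by simpa using h)
    exact hs.1.trans_lt hs.2
  | succ k ih =>
    intro a h
    rw [Function.iterate_succ_apply]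
    apply ih
    have hsub : T ∩ Ico a b ⊆ insert a (T ∩ Ico (forwardJump T a) b) := by
      rintro s ⟨hs, has, hsb⟩
      rcases has.eq_or_lt with rfl | h'
      · exact mem_insert _ _
      · exact mem_insert_of_mem _ ⟨hs, forwardJump_le hu hs h', hsb⟩
    have h1 := (encard_le_encard hsub).trans (encard_insert_le _ _)
    have h2 : ((k : ℕ∞) + 1) < (T ∩ Ico (forwardJump T a) b).encard + 1 := by
      refine lt_of_lt_of_le ?_ h1
      exact_mod_cast h
    exact lt_of_add_lt_add_right h2

theorem tendsto_forwardJump_of_forwardJump_eq (hu : ¬ BddAbove T) {t : ℝ}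
    (h : forwardJump T t = t) : Tendsto (forwardJump T) (𝓝[T] t) (𝓝 t) := by
  rw [tendsto_order]
  constructor
  · intro c hct
    filter_upwards [mem_nhdsWithin_of_mem_nhds (Ioi_mem_nhds hct)] with s hs
    exact lt_of_lt_of_le hs (le_forwardJump hu s)
  · intro c htc
    obtain ⟨r, hr, htr, hrc⟩ := exists_mem_Ioo_of_forwardJump_eq hu h htc
    filter_upwards [mem_nhdsWithin_of_mem_nhds (Iio_mem_nhds htr)] with s hs
    exact (forwardJump_le hu hr hs).trans_lt hrc

theorem tendsto_forwardJump_left (hu : ¬ BddAbove T) {t : ℝ} (ht : t ∈ T) :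
    Tendsto (forwardJump T) (𝓝[T ∩ Iio t] t) (𝓝 t) := by
  refine tendsto_of_tendsto_of_tendsto_of_le_of_le' (g := id) (h := fun _ => t)
    (tendsto_id.mono_left nhdsWithin_le_nhds) tendsto_const_nhds ?_ ?_
  · exact Eventually.of_forall fun s => le_forwardJump hu s
  · filter_upwards [self_mem_nhdsWithin] with s hs
    exact forwardJump_le hu ht hs.2

/-- Provides the admissibility of the steering input, which involves `M ∘ σ`. From the left, `s ≤
σ(s) ≤ t` squeezes `σ(s)` to `t`. -/
theorem rdContinuous_comp_forwardJump {E : Type*} [TopologicalSpace E] (hc : IsClosed T)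
    (hu : ¬ BddAbove T) {g : ℝ → E} (hg : ContinuousOn g T) :
    RdContinuous T fun t => g (forwardJump T t) := by
  constructor
  · rintro t ht ⟨-, h⟩
    have h1 : Tendsto (forwardJump T) (𝓝[T] t) (𝓝[T] t) :=
      tendsto_nhdsWithin_iff.2 ⟨tendsto_forwardJump_of_forwardJump_eq hu h,
        Eventually.of_forall fun s => forwardJump_mem hc hu s⟩
    have h2 := (hg t ht).tendsto.comp h1
    rw [ContinuousWithinAt, h]
    exact h2
  · rintro t ht -
    have h1 : Tendsto (forwardJump T) (𝓝[T ∩ Iio t] t) (𝓝[T] t) :=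
      tendsto_nhdsWithin_iff.2 ⟨tendsto_forwardJump_left hu ht,
        Eventually.of_forall fun s => forwardJump_mem hc hu s⟩
    exact ⟨g t, (hg t ht).tendsto.comp h1⟩

end Jump

/-! ### Delta derivatives and uniqueness for linear equations -/

section Deriv

variable {E F : Type*} [NormedAddCommGroup E] [NormedSpace ℝ E] [NormedAddCommGroup F]
  [NormedSpace ℝ F] {T : Set ℝ} {f : ℝ → E} {f' : E} {t : ℝ}

theorem hasDeltaDerivAt_iff_hasDerivWithinAt (h : forwardJump T t = t) :
    HasDeltaDerivAt T f f' t ↔ HasDerivWithinAt f f' T t := by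
  rw [hasDerivWithinAt_iff_isLittleO, Asymptotics.isLittleO_iff, HasDeltaDerivAt, h]
  refine forall₂_congr fun ε _ => eventually_congr (Eventually.of_forall fun s => ?_)
  rw [← norm_neg, Real.norm_eq_abs, abs_sub_comm s t]
  have : -(f t - f s - (t - s) • f') = f s - f t - (s - t) • f' := by
    module
  rw [this]

/-- With its right-dense counterpart this reduces the calculus rules to two cases: an ordinary
derivative within `T`, or a difference quotient together with continuity. -/
theorem hasDeltaDerivAt_iff_of_lt (ht : t ∈ T) (h : t < forwardJump T t) :
    HasDeltaDerivAt T f f' t ↔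
      f (forwardJump T t) = f t + (forwardJump T t - t) • f' ∧ ContinuousWithinAt f T t := by
  set σ := forwardJump T t with hσ
  have hpos : 0 < σ - t := sub_pos.2 h
  constructor
  · intro hd
    have heq : f σ = f t + (σ - t) • f' := by
      have h0 : ‖f σ - f t - (σ - t) • f'‖ ≤ 0 := by
        refine le_of_forall_pos_le_add fun ε hε => ?_
        -- The estimate holds at `s = t` itself because `t ∈ T`.
        have h1 := (hd (ε / (σ - t)) (by positivity)).self_of_nhdsWithin ht
        rw [← hσ, abs_of_pos hpos, div_mul_cancel₀ _ hpos.ne'] at h1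
        linarith
      have h1 := norm_le_zero_iff.1 h0
      rw [sub_sub, sub_eq_zero] at h1
      exact h1
    refine ⟨heq, ?_⟩
    have hlim : Tendsto (fun s => f σ - f s - (σ - s) • f') (𝓝[T] t) (𝓝 0) := by
      rw [Metric.tendsto_nhds]
      intro ε hε
      have h1 := hd (ε / (2 * (σ - t + 1))) (by positivity)
      have h2 : ∀ᶠ s in 𝓝[T] t, |σ - s| < σ - t + 1 := by
        have : Tendsto (fun s => |σ - s|) (𝓝[T] t) (𝓝 |σ - t|) :=
          ((continuous_const.sub continuous_id).abs.tendsto t).mono_left nhdsWithin_le_nhds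
        refine this.eventually (gt_mem_nhds ?_)
        rw [abs_of_pos hpos]
        linarith
      filter_upwards [h1, h2] with s hs1 hs2
      rw [dist_zero_right]
      calc _ ≤ ε / (2 * (σ - t + 1)) * |σ - s| := hs1
        _ ≤ ε / (2 * (σ - t + 1)) * (σ - t + 1) := by gcongr
        _ = ε / 2 := by field_simp
        _ < ε := by linarith
    have hlim2 : Tendsto (fun s => (σ - s) • f') (𝓝[T] t) (𝓝 ((σ - t) • f')) :=
      (((continuous_const.sub continuous_id).smul continuous_const).tendsto t).mono_left
        nhdsWithin_le_nhds
    have h3 := ((tendsto_const_nhds (x := f σ)).sub hlim2).sub hlim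
    rw [ContinuousWithinAt]
    convert h3 using 2
    · simp
    · rw [heq]; simp
  · rintro ⟨heq, hcont⟩ ε hε
    rw [← hσ]
    have h1 : Tendsto (fun s => ‖f σ - f s - (σ - s) • f'‖) (𝓝[T] t)
        (𝓝 ‖f σ - f t - (σ - t) • f'‖) :=
      ((tendsto_const_nhds.sub hcont.tendsto).sub
        ((((continuous_const.sub continuous_id).smul continuous_const).tendsto t).mono_left
          nhdsWithin_le_nhds)).norm
    have h2 : Tendsto (fun s => ε * |σ - s|) (𝓝[T] t) (𝓝 (ε * |σ - t|)) :=
      ((continuous_const.mul (continuous_const.sub continuous_id).abs).tendsto t).mono_left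
          nhdsWithin_le_nhds
    have h3 : ‖f σ - f t - (σ - t) • f'‖ < ε * |σ - t| := by
      rw [heq, abs_of_pos hpos]
      simpa using mul_pos hε hpos
    filter_upwards [h1.eventually_lt h2 h3] with s hs using hs.le

theorem HasDeltaDerivAt.eq_add (hu : ¬ BddAbove T) (ht : t ∈ T) (h : HasDeltaDerivAt T f f' t) :
    f (forwardJump T t) = f t + (forwardJump T t - t) • f' := by
  rcases (le_forwardJump hu t).eq_or_lt with h1 | h1
  · rw [← h1]; simp
  · exact ((hasDeltaDerivAt_iff_of_lt ht h1).1 h).1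

theorem HasDeltaDerivAt.continuousWithinAt (hu : ¬ BddAbove T) (ht : t ∈ T)
    (h : HasDeltaDerivAt T f f' t) : ContinuousWithinAt f T t := by
  rcases (le_forwardJump hu t).eq_or_lt with h1 | h1
  · exact ((hasDeltaDerivAt_iff_hasDerivWithinAt h1.symm).1 h).continuousWithinAt
  · exact ((hasDeltaDerivAt_iff_of_lt ht h1).1 h).2

theorem HasDeltaDerivAt.clm_apply (hu : ¬ BddAbove T) (ht : t ∈ T) (L : E →L[ℝ] F)
    (h : HasDeltaDerivAt T f f' t) : HasDeltaDerivAt T (fun s => L (f s)) (L f') t := by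
  rcases (le_forwardJump hu t).eq_or_lt with h1 | h1
  · rw [hasDeltaDerivAt_iff_hasDerivWithinAt h1.symm] at h ⊢
    exact L.hasFDerivAt.comp_hasDerivWithinAt t h
  · rw [hasDeltaDerivAt_iff_of_lt ht h1] at h ⊢
    exact ⟨by rw [h.1, map_add, map_smul],
      L.continuous.continuousAt.comp_continuousWithinAt h.2⟩

theorem HasDeltaDerivAt.add (hu : ¬ BddAbove T) (ht : t ∈ T) {g : ℝ → E} {g' : E}
    (hf : HasDeltaDerivAt T f f' t) (hg : HasDeltaDerivAt T g g' t) :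
    HasDeltaDerivAt T (fun s => f s + g s) (f' + g') t := by
  rcases (le_forwardJump hu t).eq_or_lt with h1 | h1
  · rw [hasDeltaDerivAt_iff_hasDerivWithinAt h1.symm] at hf hg ⊢
    exact hf.add hg
  · rw [hasDeltaDerivAt_iff_of_lt ht h1] at hf hg ⊢
    exact ⟨by rw [hf.1, hg.1]; module, hf.2.add hg.2⟩

theorem HasDeltaDerivAt.congr (hc : IsClosed T) (hu : ¬ BddAbove T) {g : ℝ → E}
    (hf : HasDeltaDerivAt T f f' t) (h : ∀ s ∈ T, g s = f s) : HasDeltaDerivAt T g f' t := by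
  intro ε hε
  filter_upwards [hf ε hε, self_mem_nhdsWithin] with s hs hsT
  rwa [h s hsT, h _ (forwardJump_mem hc hu t)]

/-- Constancy to the right suffices: a right-dense `t` is an accumulation point of `T ∩ Icc t b`, so
the derivative is determined there, while a right-scattered `t` has `σ(t) ≤ b`. -/
theorem HasDeltaDerivAt.eq_zero (hc : IsClosed T) (hu : ¬ BddAbove T) (ht : t ∈ T) {b : ℝ}
    (hb : b ∈ T) (htb : t < b) (h : HasDeltaDerivAt T f f' t)
    (h0 : ∀ s ∈ T, t ≤ s → s ≤ b → f s = f t) : f' = 0 := by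
  rcases (le_forwardJump hu t).eq_or_lt with h1 | h1
  · rw [hasDeltaDerivAt_iff_hasDerivWithinAt h1.symm] at h
    have h2 : HasDerivWithinAt f f' (T ∩ Icc t b) t := h.mono inter_subset_left
    have h3 : HasDerivWithinAt f 0 (T ∩ Icc t b) t :=
      (hasDerivWithinAt_const t _ (f t)).congr (fun s hs => h0 s hs.1 hs.2.1 hs.2.2) rfl
    have h4 : UniqueDiffWithinAt ℝ (T ∩ Icc t b) t := by
      rw [uniqueDiffWithinAt_iff_accPt, accPt_iff_nhds]
      intro U hU
      obtain ⟨ε, hε, hball⟩ := Metric.mem_nhds_iff.1 hU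
      obtain ⟨s, hs, hts, hsb⟩ := exists_mem_Ioo_of_forwardJump_eq hu h1.symm
        (lt_min htb (lt_add_of_pos_right t hε))
      refine ⟨s, ⟨hball ?_, hs, hts.le, (hsb.trans_le (min_le_left _ _)).le⟩, hts.ne'⟩
      have := hsb.trans_le (min_le_right _ _)
      rw [Metric.mem_ball, Real.dist_eq, abs_lt]
      constructor <;> linarith
    exact h4.eq_deriv _ h2 h3
  · have h2 := h.eq_add hu ht
    rw [h0 _ (forwardJump_mem hc hu t) h1.le (forwardJump_le hu hb htb)] at h2
    have h3 : (forwardJump T t - t) • f' = 0 := by simpa using h2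
    exact (smul_eq_zero.1 h3).resolve_left (sub_pos.2 h1).ne'

theorem HasDeltaDerivAt.inter_Ici {a : ℝ} (hat : a ≤ t) (h : HasDeltaDerivAt T f f' t) :
    HasDeltaDerivAt (T ∩ Ici a) f f' t := by
  intro ε hε
  rw [forwardJump_inter_Ici hat]
  exact (h ε hε).filter_mono (nhdsWithin_mono _ inter_subset_left)

theorem HasDeltaDerivAt.of_inter_Ici {a : ℝ} (hat : a < t)
    (h : HasDeltaDerivAt (T ∩ Ici a) f f' t) : HasDeltaDerivAt T f f' t := by
  intro ε hε
  have h1 := h ε hε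
  rwa [forwardJump_inter_Ici hat.le, nhdsWithin_inter_of_mem'
    (mem_nhdsWithin_of_mem_nhds (Ici_mem_nhds hat))] at h1

/-- A solution of a homogeneous linear dynamic equation that vanishes at `a` vanishes from `a` on. -/
theorem eq_zero_of_hasDeltaDerivAt_clm (hc : IsClosed T) (hu : ¬ BddAbove T) {a : ℝ} (ha : a ∈ T)
    (L : E →L[ℝ] E) {z : ℝ → E} (hz : ∀ t ∈ T, a ≤ t → HasDeltaDerivAt T z (L (z t)) t)
    (h0 : z a = 0) : ∀ t ∈ T, a ≤ t → z t = 0 := by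
  set K := ‖L‖ with hK
  have hK0 : 0 ≤ K := norm_nonneg L
  -- The rate `K + 1` instead of `K` leaves room to absorb the `o(s - t)` error at right-dense
  -- points.
  have key : ∀ ε > 0, ∀ t ∈ T, a ≤ t → ‖z t‖ ≤ ε * Real.exp ((K + 1) * (t - a)) := by
    intro ε hε
    have hgrow : ∀ t s, t ≤ s → (1 + (K + 1) * (s - t)) * (ε * Real.exp ((K + 1) * (t - a))) ≤
        ε * Real.exp ((K + 1) * (s - a)) := by
      intro t s hts
      have h1 := Real.add_one_le_exp ((K + 1) * (s - t))
      have h2 : Real.exp ((K + 1) * (s - a)) =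
          Real.exp ((K + 1) * (s - t)) * Real.exp ((K + 1) * (t - a)) := by
        rw [← Real.exp_add]; ring_nf
      rw [h2]
      have h3 := mul_le_mul_of_nonneg_right h1
        (mul_nonneg hε.le (Real.exp_pos ((K + 1) * (t - a))).le)
      linarith
    refine induction_Ici hc hu ha ?_ ?_ ?_ ?_
    · simp [h0, hε.le]
    · intro t ht hat hlt hP
      refine le_trans ?_ (hgrow t _ hlt.le)
      rw [(hz t ht hat).eq_add hu ht]
      have hμ : 0 < forwardJump T t - t := sub_pos.2 hlt
      calc _ ≤ ‖z t‖ + (forwardJump T t - t) * (K * ‖z t‖) := by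
            refine (norm_add_le _ _).trans ?_
            rw [norm_smul, Real.norm_of_nonneg hμ.le]
            gcongr
            exact L.le_opNorm _
        _ = (1 + K * (forwardJump T t - t)) * ‖z t‖ := by ring
        _ ≤ _ := by
          gcongr
          linarith
    · intro t ht hat heq hP
      have h1 := (hasDeltaDerivAt_iff_hasDerivWithinAt heq).1 (hz t ht hat)
      rw [hasDerivWithinAt_iff_isLittleO, Asymptotics.isLittleO_iff] at h1
      have h2 := (h1 hε).filter_mono (nhdsWithin_mono t (inter_subset_left (t := Ioi t)))
      filter_upwards [h2, self_mem_nhdsWithin] with s hs hsT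
      have hst : 0 < s - t := sub_pos.2 hsT.2
      refine le_trans ?_ (hgrow t s hsT.2.le)
      have h3 : z s = (z s - z t - (s - t) • L (z t)) + z t + (s - t) • L (z t) := by abel
      have h4 : ε ≤ ε * Real.exp ((K + 1) * (t - a)) :=
        le_mul_of_one_le_right hε.le (Real.one_le_exp (by
          have := sub_nonneg.2 hat
          positivity))
      rw [Real.norm_of_nonneg hst.le] at hs
      have h5 : ‖(s - t) • L (z t)‖ ≤ (s - t) * (K * ‖z t‖) := by
        rw [norm_smul, Real.norm_of_nonneg hst.le]
        gcongr
        exact L.le_opNorm _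
      calc ‖z s‖ ≤ ‖z s - z t - (s - t) • L (z t)‖ + ‖z t‖ + ‖(s - t) • L (z t)‖ := by
            conv_lhs => rw [h3]
            exact norm_add₃_le
        _ ≤ ε * (s - t) + ‖z t‖ + (s - t) * (K * ‖z t‖) := by gcongr
        _ = ε * (s - t) + (1 + K * (s - t)) * ‖z t‖ := by ring
        _ ≤ (ε * Real.exp ((K + 1) * (t - a))) * (s - t) +
            (1 + K * (s - t)) * (ε * Real.exp ((K + 1) * (t - a))) := by gcongr
        _ = _ := by ring
    · intro t ht hat hcl hP
      have hne : (𝓝[T ∩ Iio t] t).NeBot := mem_closure_iff_nhdsWithin_neBot.1 hcl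
      have hcont := ((hz t ht hat.le).continuousWithinAt hu ht).mono
        (inter_subset_left (t := Iio t))
      have h2 : Tendsto (fun s => ε * Real.exp ((K + 1) * (s - a))) (𝓝[T ∩ Iio t] t)
          (𝓝 (ε * Real.exp ((K + 1) * (t - a)))) :=
        (Continuous.tendsto (by fun_prop) t).mono_left nhdsWithin_le_nhds
      refine le_of_tendsto_of_tendsto hcont.tendsto.norm h2 ?_
      filter_upwards [self_mem_nhdsWithin, mem_nhdsWithin_of_mem_nhds (Ioi_mem_nhds hat)]
        with s hs has
      exact hP s hs.1 (le_of_lt has) hs.2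
  intro t ht hat
  have h1 : ‖z t‖ ≤ 0 := by
    refine le_of_forall_pos_le_add fun ε hε => ?_
    have h2 := key (ε / Real.exp ((K + 1) * (t - a))) (by positivity) t ht hat
    rw [div_mul_cancel₀ _ (Real.exp_pos _).ne'] at h2
    linarith
  exact norm_le_zero_iff.1 h1

end Deriv

/-! ### Product and inverse rules -/

section Algebra

variable {R : Type*} [NormedRing R] [NormedAlgebra ℝ R] {T : Set ℝ} {f g : ℝ → R} {f' g' : R}
  {t : ℝ}

theorem HasDeltaDerivAt.mul (hu : ¬ BddAbove T) (ht : t ∈ T)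
    (hf : HasDeltaDerivAt T f f' t) (hg : HasDeltaDerivAt T g g' t) :
    HasDeltaDerivAt T (fun s => f s * g s) (f' * g t + f (forwardJump T t) * g') t := by
  rcases (le_forwardJump hu t).eq_or_lt with h1 | h1
  · rw [← h1]
    rw [hasDeltaDerivAt_iff_hasDerivWithinAt h1.symm] at hf hg ⊢
    exact hf.mul hg
  · rw [hasDeltaDerivAt_iff_of_lt ht h1] at hf hg ⊢
    refine ⟨?_, hf.2.mul hg.2⟩
    rw [hg.1, hf.1]
    simp only [mul_add, add_mul, smul_mul_assoc, mul_smul_comm, smul_add]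
    abel

theorem HasDeltaDerivAt.inverse [HasSummableGeomSeries R] (hc : IsClosed T) (hu : ¬ BddAbove T)
    (ht : t ∈ T)
    (hf : HasDeltaDerivAt T f f' t) (hunit : ∀ s ∈ T, IsUnit (f s)) :
    HasDeltaDerivAt T (fun s => Ring.inverse (f s))
      (-(Ring.inverse (f (forwardJump T t)) * f' * Ring.inverse (f t))) t := by
  obtain ⟨v, hv⟩ := hunit t ht
  rcases (le_forwardJump hu t).eq_or_lt with h1 | h1
  · rw [← h1]
    rw [hasDeltaDerivAt_iff_hasDerivWithinAt h1.symm] at hf ⊢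
    have h2 := hasFDerivAt_ringInverse (𝕜 := ℝ) v
    rw [hv] at h2
    have h3 := h2.comp_hasDerivWithinAt t hf
    rw [← hv, Ring.inverse_unit]
    exact h3.congr_deriv (by simp)
  · obtain ⟨w, hw⟩ := hunit _ (forwardJump_mem hc hu t)
    rw [hasDeltaDerivAt_iff_of_lt ht h1] at hf ⊢
    constructor
    · have h2 := hf.1
      rw [← hv, ← hw] at h2 ⊢
      rw [Ring.inverse_unit, Ring.inverse_unit]
      have h3 : (forwardJump T t - t) • f' = (w : R) - v := by rw [h2]; abel
      rw [smul_neg, ← smul_mul_assoc, ← mul_smul_comm, h3]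
      simp [mul_sub, sub_mul]
    · have h2 := NormedRing.inverse_continuousAt v
      rw [hv] at h2
      exact h2.comp_continuousWithinAt hf.2

end Algebra

/-- The last point of `T` up to `r`, or the minimum of `T` if there is none. -/
noncomputable def lastPoint (T : Set ℝ) (r : ℝ) : ℝ :=
  open Classical in if (T ∩ Iic r).Nonempty then sSup (T ∩ Iic r) else sInf T

/-! ### Last points, which extend functions from `T` to step functions on `ℝ` -/

section LastPoint

variable {T : Set ℝ}

theorem bddAbove_inter_Iic (r : ℝ) : BddAbove (T ∩ Iic r) := ⟨r, fun _ hs => hs.2⟩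

theorem bddBelow_of_inter_Iic_eq_empty {r : ℝ} (h : ¬ (T ∩ Iic r).Nonempty) : BddBelow T :=
  ⟨r, fun s hs => le_of_not_ge fun hsr => h ⟨s, hs, hsr⟩⟩

theorem lastPoint_mem (hc : IsClosed T) (hne : T.Nonempty) (r : ℝ) : lastPoint T r ∈ T := by
  unfold lastPoint
  split_ifs with h
  · exact hc.closure_subset
      (closure_mono inter_subset_left (csSup_mem_closure h (bddAbove_inter_Iic r)))
  · exact hc.csInf_mem hne (bddBelow_of_inter_Iic_eq_empty h)

theorem lastPoint_mono : Monotone (lastPoint T) := by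
  intro a b hab
  have hsub : T ∩ Iic a ⊆ T ∩ Iic b := inter_subset_inter_right _ (Iic_subset_Iic.2 hab)
  unfold lastPoint
  split_ifs with ha hb hb
  · exact csSup_le_csSup (bddAbove_inter_Iic b) ha hsub
  · exact absurd (ha.mono hsub) hb
  · obtain ⟨s, hs⟩ := hb
    exact (csInf_le (bddBelow_of_inter_Iic_eq_empty ha) hs.1).trans
      (le_csSup (bddAbove_inter_Iic b) hs)
  · exact le_rfl

theorem le_lastPoint {s r : ℝ} (hs : s ∈ T) (hsr : s ≤ r) : s ≤ lastPoint T r := by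
  rw [lastPoint, if_pos ⟨s, hs, hsr⟩]
  exact le_csSup (bddAbove_inter_Iic r) ⟨hs, hsr⟩

theorem lastPoint_le {s r : ℝ} (hs : s ∈ T) (hsr : s ≤ r) : lastPoint T r ≤ r := by
  have h : (T ∩ Iic r).Nonempty := ⟨s, hs, hsr⟩
  rw [lastPoint, if_pos h]
  exact csSup_le h fun _ hx => hx.2

theorem lastPoint_eq_of_mem_Ico (hu : ¬ BddAbove T) {t r : ℝ} (ht : t ∈ T) (htr : t ≤ r)
    (hr : r < forwardJump T t) : lastPoint T r = t := by
  refine le_antisymm ?_ (le_lastPoint ht htr)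
  have h : (T ∩ Iic r).Nonempty := ⟨t, ht, htr⟩
  rw [lastPoint, if_pos h]
  refine csSup_le h fun s hs => ?_
  by_contra hts
  push Not at hts
  exact absurd ((forwardJump_le hu hs.1 hts).trans hs.2) (not_le.2 hr)

end LastPoint

/-! ### Delta antiderivatives -/

section Integral

variable {E : Type*} [NormedAddCommGroup E] {T : Set ℝ}

/-- Measurability is free because `lastPoint T` is monotone. -/
theorem intervalIntegrable_comp_lastPoint (hc : IsClosed T) (hne : T.Nonempty) {f : ℝ → E}
    (hm : MeasureTheory.StronglyMeasurable fun s : T => f s)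
    (hb : ∀ a b, ∃ C, ∀ t ∈ T, a ≤ t → t ≤ b → ‖f t‖ ≤ C) (a b : ℝ) :
    IntervalIntegrable (fun r => f (lastPoint T r)) MeasureTheory.volume a b := by
  have hmeas : MeasureTheory.StronglyMeasurable fun r => f (lastPoint T r) :=
    hm.comp_measurable (g := fun r => (⟨lastPoint T r, lastPoint_mem hc hne r⟩ : T))
      (lastPoint_mono.measurable.subtype_mk)
  obtain ⟨C, hC⟩ := hb (lastPoint T (min a b)) (lastPoint T (max a b))
  rw [intervalIntegrable_iff]
  refine MeasureTheory.Measure.integrableOn_of_bounded (M := C) ?_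
    hmeas.aestronglyMeasurable ?_
  · simp [uIoc]
  · refine (MeasureTheory.ae_restrict_iff' measurableSet_uIoc).2 (Eventually.of_forall ?_)
    intro r hr
    exact hC _ (lastPoint_mem hc hne r) (lastPoint_mono hr.1.le) (lastPoint_mono hr.2)

theorem exists_bound_of_continuousOn (hc : IsClosed T) {f : ℝ → E} (hf : ContinuousOn f T)
    (a b : ℝ) : ∃ C, ∀ t ∈ T, a ≤ t → t ≤ b → ‖f t‖ ≤ C := by
  have hK : IsCompact (T ∩ Icc a b) := isCompact_Icc.inter_left hc
  obtain ⟨C, hC⟩ := hK.exists_bound_of_continuousOn (hf.mono inter_subset_left)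
  exact ⟨C, fun t ht h1 h2 => hC t ⟨ht, h1, h2⟩⟩

theorem intervalIntegrable_comp_lastPoint_of_continuousOn (hc : IsClosed T) (hne : T.Nonempty)
    {f : ℝ → E} (hf : ContinuousOn f T) (a b : ℝ) :
    IntervalIntegrable (fun r => f (lastPoint T r)) MeasureTheory.volume a b :=
  intervalIntegrable_comp_lastPoint hc hne hf.domRestrict.stronglyMeasurable
    (exists_bound_of_continuousOn hc hf) a b

theorem intervalIntegrable_comp_forwardJump (hc : IsClosed T) (hu : ¬ BddAbove T)
    (hne : T.Nonempty) {f : ℝ → E} (hf : ContinuousOn f T) (a b : ℝ) :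
    IntervalIntegrable (fun r => f (forwardJump T (lastPoint T r))) MeasureTheory.volume a b := by
  refine intervalIntegrable_comp_lastPoint (f := fun t => f (forwardJump T t)) hc hne ?_ ?_ a b
  · have hmono : Measurable fun s : T => (⟨forwardJump T s, forwardJump_mem hc hu s⟩ : T) :=
      ((forwardJump_mono hu).measurable.comp measurable_subtype_coe).subtype_mk
    exact hf.domRestrict.stronglyMeasurable.comp_measurable hmono
  · intro a b
    obtain ⟨C, hC⟩ := exists_bound_of_continuousOn hc hf a (forwardJump T b)
    exact ⟨C, fun t ht h1 h2 => hC _ (forwardJump_mem hc hu t)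
      (h1.trans (le_forwardJump hu t)) (forwardJump_mono hu h2)⟩

variable [NormedSpace ℝ E]

/-- The integral of the piecewise constant extension of `f` is a delta antiderivative of `f`. -/
theorem hasDeltaDerivAt_integral [CompleteSpace E] (hu : ¬ BddAbove T) {f : ℝ → E}
    (hint : ∀ a b, IntervalIntegrable (fun r => f (lastPoint T r)) MeasureTheory.volume a b)
    (hf : ∀ t ∈ T, forwardJump T t = t → ContinuousWithinAt f T t) (hc : IsClosed T) (a : ℝ)
    {t : ℝ} (ht : t ∈ T) :
    HasDeltaDerivAt T (fun s => ∫ r in a..s, f (lastPoint T r)) (f t) t := by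
  have hdiff : ∀ s, (∫ r in a..s, f (lastPoint T r)) - (∫ r in a..t, f (lastPoint T r)) =
      ∫ r in t..s, f (lastPoint T r) := fun s =>
    intervalIntegral.integral_interval_sub_left (hint a s) (hint a t)
  rcases (le_forwardJump hu t).eq_or_lt with h1 | h1
  · rw [hasDeltaDerivAt_iff_hasDerivWithinAt h1.symm, hasDerivWithinAt_iff_isLittleO,
      Asymptotics.isLittleO_iff]
    intro ε hε
    have h2 := Metric.continuousWithinAt_iff.1 (hf t ht h1.symm) ε hε
    obtain ⟨δ, hδ, h3⟩ := h2
    filter_upwards [self_mem_nhdsWithin, mem_nhdsWithin_of_mem_nhds (Metric.ball_mem_nhds t hδ)]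
      with s hs hsδ
    have h4 : (∫ r in a..s, f (lastPoint T r)) - (∫ r in a..t, f (lastPoint T r)) - (s - t) • f t
        = ∫ r in t..s, (f (lastPoint T r) - f t) := by
      rw [hdiff, intervalIntegral.integral_sub (hint t s) intervalIntegrable_const,
        intervalIntegral.integral_const]
    rw [h4, Real.norm_eq_abs]
    refine intervalIntegral.norm_integral_le_of_norm_le_const fun r hr => ?_
    -- Both ends of the interval lie in `T`, so `lastPoint T r` stays between them and within `δ` of
    -- `t`.
    have hmin : min t s ∈ T := by
      rcases min_choice t s with h | h <;> rw [h] <;> assumption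
    have h5 : min t s ≤ lastPoint T r := le_lastPoint hmin hr.1.le
    have h6 : lastPoint T r ≤ max t s := (lastPoint_le hmin hr.1.le).trans hr.2
    rw [← dist_eq_norm]
    refine (h3 (lastPoint_mem hc ⟨t, ht⟩ r) ?_).le
    rw [Metric.mem_ball, Real.dist_eq, abs_lt] at hsδ
    rw [Real.dist_eq, abs_lt]
    constructor
    · have := lt_min (show t - δ < t by linarith) (show t - δ < s by linarith)
      linarith
    · have := max_lt (show t < t + δ by linarith) (show s < t + δ by linarith)
      linarith
  · rw [hasDeltaDerivAt_iff_of_lt ht h1]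
    constructor
    -- The step extension equals `f t` on the open gap `(t, σ(t))`; the endpoint `σ(t)` is dropped
    -- as a null set.
    · rw [← sub_eq_iff_eq_add', hdiff, intervalIntegral.integral_of_le h1.le,
        MeasureTheory.integral_Ioc_eq_integral_Ioo,
        MeasureTheory.setIntegral_congr_fun measurableSet_Ioo (g := fun _ => f t)]
      · simp [h1.le]
      · intro r hr
        simp only [lastPoint_eq_of_mem_Ico hu ht hr.1.le hr.2]
    · exact (intervalIntegral.continuous_primitive hint a).continuousWithinAt

end Integral

/-! ### Exponential series and fundamental solutions -/

section Exponential

/-- The generalized monomials `h_k(·, a)` of a time scale. -/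
noncomputable def monomial (T : Set ℝ) (a : ℝ) : ℕ → ℝ → ℝ
  | 0 => fun _ => 1
  | k + 1 => fun t => ∫ r in a..t, monomial T a k (lastPoint T r)

variable {T : Set ℝ} {a : ℝ}

theorem continuous_monomial (hc : IsClosed T) (hne : T.Nonempty) (k : ℕ) :
    Continuous (monomial T a k) := by
  induction k with
  | zero => exact continuous_const
  | succ k ih =>
    exact intervalIntegral.continuous_primitive
      (intervalIntegrable_comp_lastPoint_of_continuousOn hc hne ih.continuousOn) a

/-- Since `lastPoint T r ≤ r`, each iterated integral is dominated by its classical counterpart on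
`ℝ`. -/
theorem abs_monomial_le (ha : a ∈ T) (k : ℕ) :
    ∀ t, a ≤ t → |monomial T a k t| ≤ (t - a) ^ k / k.factorial := by
  induction k with
  | zero => intro t _; simp [monomial]
  | succ k ih =>
    intro t hat
    have hcont : Continuous fun r : ℝ => (r - a) ^ k / (k.factorial : ℝ) := by fun_prop
    have h1 : ‖∫ r in a..t, monomial T a k (lastPoint T r)‖ ≤
        ∫ r in a..t, (r - a) ^ k / (k.factorial : ℝ) := by
      refine intervalIntegral.norm_integral_le_of_norm_le hat (Eventually.of_forall ?_)
        (hcont.intervalIntegrable _ _)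
      intro r hr
      have h2 := le_lastPoint ha hr.1.le
      refine (ih _ h2).trans ?_
      have h3 := lastPoint_le ha hr.1.le
      have h4 : 0 ≤ lastPoint T r - a := sub_nonneg.2 h2
      gcongr
    refine h1.trans (le_of_eq ?_)
    rw [intervalIntegral.integral_div, intervalIntegral.integral_comp_sub_right (fun r => r ^ k),
      integral_pow, Nat.factorial_succ]
    push_cast
    field_simp
    simp

variable {R : Type*} [NormedRing R]

theorem norm_pow_le_norm_one_mul (x : R) (k : ℕ) : ‖x ^ k‖ ≤ ‖(1 : R)‖ * ‖x‖ ^ k := by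
  induction k with
  | zero => simp
  | succ k ih =>
    rw [pow_succ, pow_succ, ← mul_assoc]
    exact (norm_mul_le _ _).trans (by gcongr)

theorem summable_norm_one_mul (x : R) (c : ℝ) :
    Summable fun k : ℕ => ‖(1 : R)‖ * ((c * ‖x‖) ^ k / k.factorial) :=
  (Real.summable_pow_div_factorial _).mul_left _

variable [NormedAlgebra ℝ R]

theorem norm_monomial_smul_pow_le (ha : a ∈ T) (x : R) (k : ℕ) {t b : ℝ} (hat : a ≤ t)
    (htb : t ≤ b) :
    ‖monomial T a k t • x ^ k‖ ≤ ‖(1 : R)‖ * (((b - a) * ‖x‖) ^ k / k.factorial) := by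
  rw [norm_smul, Real.norm_eq_abs]
  have h0 : 0 ≤ t - a := sub_nonneg.2 hat
  calc |monomial T a k t| * ‖x ^ k‖
      ≤ ((b - a) ^ k / k.factorial) * (‖(1 : R)‖ * ‖x‖ ^ k) := by
        have h1 : |monomial T a k t| ≤ (b - a) ^ k / k.factorial :=
          (abs_monomial_le ha k t hat).trans (by gcongr)
        exact mul_le_mul h1 (norm_pow_le_norm_one_mul x k) (norm_nonneg _)
          ((abs_nonneg _).trans h1)
    _ = _ := by rw [mul_pow]; ring

theorem eq_of_hasDeltaDerivAt_mul (hc : IsClosed T) (hu : ¬ BddAbove T) (ha : a ∈ T) (x : R)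
    {Y Z : ℝ → R} (hY : ∀ t ∈ T, a ≤ t → HasDeltaDerivAt T Y (x * Y t) t)
    (hZ : ∀ t ∈ T, a ≤ t → HasDeltaDerivAt T Z (x * Z t) t) (h : Y a = Z a) :
    ∀ t ∈ T, a ≤ t → Y t = Z t := by
  have h1 : ∀ t ∈ T, a ≤ t → HasDeltaDerivAt T (fun s => Y s + -Z s)
      (ContinuousLinearMap.mul ℝ R x (Y t + -Z t)) t := by
    intro t ht hat
    have h2 := (hY t ht hat).add hu ht ((hZ t ht hat).clm_apply hu ht (-ContinuousLinearMap.id ℝ R))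
    simpa [mul_sub, sub_eq_add_neg, mul_add] using h2
  intro t ht hat
  have h3 := eq_zero_of_hasDeltaDerivAt_clm hc hu ha _ h1 (by simp [h]) t ht hat
  exact add_neg_eq_zero.1 h3

theorem HasDeltaDerivAt.mul_const (hu : ¬ BddAbove T) {t : ℝ} (ht : t ∈ T) {Y : ℝ → R} {Y' : R}
    (h : HasDeltaDerivAt T Y Y' t) (c : R) : HasDeltaDerivAt T (fun s => Y s * c) (Y' * c) t :=
  h.clm_apply hu ht ((ContinuousLinearMap.mul ℝ R).flip c)

variable [CompleteSpace R]

/-- The exponential series solves `E^Δ = x E`, `E(a) = 1` on a time scale with minimum `a`. -/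
theorem exists_deltaExp_of_isLeast (hc : IsClosed T) (hu : ¬ BddAbove T) (ha : IsLeast T a)
    (x : R) : ∃ E : ℝ → R, E a = 1 ∧ (∀ t ∈ T, HasDeltaDerivAt T E (x * E t) t) ∧
      ∀ t ∈ T, ‖E t - 1‖ ≤ ‖x‖ * (‖(1 : R)‖ * Real.exp ((t - a) * ‖x‖)) * (t - a) := by
  have hne : T.Nonempty := ⟨a, ha.1⟩
  set E : ℝ → R := fun t => ∑' k, monomial T a k t • x ^ k with hE
  have hsum : ∀ t, a ≤ t → HasSum (fun k => monomial T a k t • x ^ k) (E t) := fun t hat =>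
    (Summable.of_norm_bounded (summable_norm_one_mul x (t - a))
      fun k => norm_monomial_smul_pow_le ha.1 x k hat le_rfl).hasSum
  have hcontE : ContinuousOn E T := by
    intro t ht
    have h1 : ContinuousOn E (Icc a (t + 1)) :=
      continuousOn_tsum (fun k => ((continuous_monomial hc hne k).smul
        continuous_const).continuousOn) (summable_norm_one_mul x (t + 1 - a))
        fun k s hs => norm_monomial_smul_pow_le ha.1 x k hs.1 hs.2
    refine (h1 t ⟨ha.2 ht, by linarith⟩).mono_of_mem_nhdsWithin ?_
    filter_upwards [self_mem_nhdsWithin,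
      mem_nhdsWithin_of_mem_nhds (Iic_mem_nhds (lt_add_one t))] with s hs hst
    exact ⟨ha.2 hs, hst⟩
  -- Termwise integration of `x E` shifts the series by one index.
  have hint : ∀ t, a ≤ t → E t = 1 + ∫ r in a..t, x * E (lastPoint T r) := by
    intro t hat
    have h1 : HasSum (fun k => ∫ r in a..t, monomial T a k (lastPoint T r) • x ^ (k + 1))
        (∫ r in a..t, x * E (lastPoint T r)) := by
      refine intervalIntegral.hasSum_integral_of_dominated_convergence
        (fun k _ => ‖x‖ * (‖(1 : R)‖ * (((t - a) * ‖x‖) ^ k / k.factorial)))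
        (fun k => ?_) (fun k => Eventually.of_forall fun r hr => ?_)
        (Eventually.of_forall fun r _ => (summable_norm_one_mul x (t - a)).mul_left _)
        intervalIntegrable_const (Eventually.of_forall fun r hr => ?_)
      · exact (((continuous_monomial hc hne k).measurable.comp
          lastPoint_mono.measurable).stronglyMeasurable.smul_const _).aestronglyMeasurable
      · rw [uIoc_of_le hat] at hr
        rw [pow_succ', ← mul_smul_comm]
        refine (norm_mul_le _ _).trans ?_
        gcongr
        exact norm_monomial_smul_pow_le ha.1 x k (le_lastPoint ha.1 hr.1.le)
          ((lastPoint_le ha.1 hr.1.le).trans hr.2)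
      · rw [uIoc_of_le hat] at hr
        have h2 := (hsum _ (le_lastPoint ha.1 hr.1.le)).mul_left x
        simpa only [pow_succ', mul_smul_comm] using h2
    have h2 := (hasSum_nat_add_iff' 1).2 (hsum t hat)
    have h3 : (fun k => monomial T a (k + 1) t • x ^ (k + 1)) =
        fun k => ∫ r in a..t, monomial T a k (lastPoint T r) • x ^ (k + 1) := by
      funext k
      rw [intervalIntegral.integral_smul_const]
      rfl
    rw [h3] at h2
    have h4 := h2.unique h1
    simp only [Finset.range_one, Finset.sum_singleton, pow_zero] at h4
    rw [← h4]
    simp [monomial]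
  have hnorm : ∀ t, a ≤ t → ‖E t‖ ≤ ‖(1 : R)‖ * Real.exp ((t - a) * ‖x‖) := by
    intro t hat
    refine (hsum t hat).norm_le_of_bounded ?_
      fun k => norm_monomial_smul_pow_le ha.1 x k hat le_rfl
    have := NormedSpace.expSeries_div_hasSum_exp ((t - a) * ‖x‖)
    rw [← Real.exp_eq_exp_ℝ] at this
    exact this.mul_left _
  refine ⟨E, ?_, fun t ht => ?_, fun t ht => ?_⟩
  · rw [hint a le_rfl]
    simp
  · have hcont : ContinuousOn (fun s => x * E s) T := continuousOn_const.mul hcontE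
    have h1 := hasDeltaDerivAt_integral (f := fun s => x * E s) hu
      (intervalIntegrable_comp_lastPoint_of_continuousOn hc hne hcont)
      (fun t ht _ => hcont t ht) hc a ht
    have h2 : HasDeltaDerivAt T (fun _ => (1 : R)) 0 t := by
      intro ε hε
      refine Eventually.of_forall fun s => ?_
      simp only [sub_self, smul_zero, norm_zero]
      positivity
    have h3 := h2.add hu ht h1
    rw [zero_add] at h3
    exact h3.congr hc hu fun s hs => hint s (ha.2 hs)
  · have hat := ha.2 ht
    rw [hint t hat, add_sub_cancel_left]
    refine (intervalIntegral.norm_integral_le_of_norm_le_const (C := ‖x‖ * (‖(1 : R)‖ *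
      Real.exp ((t - a) * ‖x‖))) fun r hr => ?_).trans_eq (by
        rw [abs_of_nonneg (sub_nonneg.2 hat)])
    rw [uIoc_of_le hat] at hr
    refine (norm_mul_le _ _).trans ?_
    gcongr
    refine (hnorm _ (le_lastPoint ha.1 hr.1.le)).trans ?_
    have := (lastPoint_le ha.1 hr.1.le).trans hr.2
    gcongr

/-- A regressive homogeneous linear dynamic equation has an invertible fundamental solution on the
whole time scale. -/
theorem exists_fundamental_solution (hc : IsClosed T) (hu : ¬ BddAbove T) {t₀ : ℝ} (ht₀ : t₀ ∈ T)
    (x : R) (hreg : ∀ t ∈ T, IsUnit (1 + graininess T t • x)) :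
    ∃ X : ℝ → R, X t₀ = 1 ∧ (∀ t ∈ T, HasDeltaDerivAt T X (x * X t) t) ∧
      ∀ t ∈ T, IsUnit (X t) := by
  have hex : ∀ a ∈ T, ∃ E : ℝ → R, E a = 1 ∧
      (∀ t ∈ T ∩ Ici a, HasDeltaDerivAt (T ∩ Ici a) E (x * E t) t) ∧
      ∀ t ∈ T ∩ Ici a, ‖E t - 1‖ ≤ ‖x‖ * (‖(1 : R)‖ * Real.exp ((t - a) * ‖x‖)) * (t - a) :=
    fun a ha => exists_deltaExp_of_isLeast (hc.inter isClosed_Ici) (not_bddAbove_inter_Ici hu a)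
      ⟨⟨ha, self_mem_Ici⟩, fun s hs => hs.2⟩ x
  choose! Φ hone hderiv hbound using hex
  -- Both sides solve the same equation on `T ∩ Ici b` and agree at `b`.
  have hcocycle : ∀ a ∈ T, ∀ b ∈ T, a ≤ b → ∀ t ∈ T, b ≤ t → Φ a t = Φ b t * Φ a b := by
    intro a ha b hb hab t ht hbt
    have hub := not_bddAbove_inter_Ici hu b
    refine eq_of_hasDeltaDerivAt_mul (T := T ∩ Ici b) (hc.inter isClosed_Ici) hub
      ⟨hb, self_mem_Ici⟩ x (Z := fun t => Φ b t * Φ a b) (fun s hs _ => ?_) (fun s hs _ => ?_) ?_ t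
      ⟨ht, hbt⟩ hbt
    · have h1 := (hderiv a ha s ⟨hs.1, hab.trans hs.2⟩).inter_Ici hs.2
      rwa [inter_assoc, Ici_inter_Ici, sup_eq_right.2 hab] at h1
    · rw [← mul_assoc]
      exact (hderiv b hb s hs).mul_const hub hs _
    · simp [hone b hb]
  have hunit : ∀ a ∈ T, ∀ t ∈ T, a ≤ t → IsUnit (Φ a t) := by
    intro a ha
    have hua := not_bddAbove_inter_Ici hu a
    refine induction_Ici hc hu ha ?_ ?_ ?_ ?_
    · simp [hone a ha]
    · intro t ht hat _ hP
      have h1 := (hderiv a ha t ⟨ht, hat⟩).eq_add hua ⟨ht, hat⟩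
      rw [forwardJump_inter_Ici hat] at h1
      rw [h1, ← smul_mul_assoc, ← one_add_mul]
      exact (hreg t ht).mul hP
    · intro t ht hat _ hP
      have h1 := ((hderiv a ha t ⟨ht, hat⟩).continuousWithinAt hua ⟨ht, hat⟩).mono
        (show T ∩ Ioi t ⊆ T ∩ Ici a from fun s hs => ⟨hs.1, hat.trans (le_of_lt hs.2)⟩)
      exact h1.tendsto.eventually (Units.isOpen.mem_nhds hP)
    -- A limit of units need not be a unit. Here `Φ a t = Φ s t * Φ a s`, and the bound on `Φ s t -
    -- 1` tends to `0` as `s` tends to `t` from the left, so the first factor is a unit for some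
    -- such `s`.
    · intro t ht hat hcl hP
      have hne : (𝓝[T ∩ Iio t] t).NeBot := mem_closure_iff_nhdsWithin_neBot.1 hcl
      have hlim : Tendsto (fun s => ‖x‖ * (‖(1 : R)‖ * Real.exp ((t - s) * ‖x‖)) * (t - s))
          (𝓝[T ∩ Iio t] t) (𝓝 0) := by
        have h1 : Continuous fun s => ‖x‖ * (‖(1 : R)‖ * Real.exp ((t - s) * ‖x‖)) * (t - s) := by
          fun_prop
        have h2 := (h1.tendsto t).mono_left (nhdsWithin_le_nhds (s := T ∩ Iio t))
        simpa using h2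
      obtain ⟨s, ⟨hs1, hsa⟩, hs, hst⟩ := (((hlim.eventually (gt_mem_nhds one_pos)).and
        (mem_nhdsWithin_of_mem_nhds (Ioi_mem_nhds hat))).and self_mem_nhdsWithin).exists
      have has : a ≤ s := le_of_lt hsa
      rw [hcocycle a ha s hs has t ht (le_of_lt hst)]
      refine IsUnit.mul ?_ (hP s hs has hst)
      have h3 := isUnit_one_sub_of_norm_lt_one (x := 1 - Φ s t)
        (by rw [norm_sub_rev]; exact (hbound s hs t ⟨ht, mem_Ici.2 (le_of_lt hst)⟩).trans_lt hs1)
      simpa using h3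
  set X : ℝ → R := fun t => if t₀ ≤ t then Φ t₀ t else Ring.inverse (Φ t t₀) with hX
  -- Seen from any base `a ≤ t₀`, the glued function is `Φ a` times a constant, so it solves the
  -- equation across `t₀` too.
  have hXeq : ∀ a ∈ T, a ≤ t₀ → ∀ t ∈ T, a ≤ t → X t = Φ a t * Ring.inverse (Φ a t₀) := by
    intro a ha hat₀ t ht hat
    by_cases h : t₀ ≤ t
    · simp only [hX, if_pos h]
      rw [hcocycle a ha t₀ ht₀ hat₀ t ht h, mul_assoc,
        Ring.mul_inverse_cancel _ (hunit a ha t₀ ht₀ hat₀), mul_one]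
    · simp only [hX, if_neg h]
      push Not at h
      have h1 := hunit t ht t₀ ht₀ h.le
      have h2 := hcocycle a ha t ht hat t₀ ht₀ h.le
      calc Ring.inverse (Φ t t₀)
          = Ring.inverse (Φ t t₀) * (Φ a t₀ * Ring.inverse (Φ a t₀)) := by
            rw [Ring.mul_inverse_cancel _ (hunit a ha t₀ ht₀ hat₀), mul_one]
        _ = Ring.inverse (Φ t t₀) * (Φ t t₀ * Φ a t * Ring.inverse (Φ a t₀)) := by rw [← h2]
        _ = Ring.inverse (Φ t t₀) * Φ t t₀ * (Φ a t * Ring.inverse (Φ a t₀)) := by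
            simp only [mul_assoc]
        _ = _ := by rw [Ring.inverse_mul_cancel _ h1, one_mul]
  refine ⟨X, ?_, fun t ht => ?_, fun t ht => ?_⟩
  · simp [hX, hone t₀ ht₀]
  · have hlocal : ∀ a ∈ T, a ≤ t₀ → a ≤ t → HasDeltaDerivAt (T ∩ Ici a) X (x * X t) t := by
      intro a ha hat₀ hat
      have hua := not_bddAbove_inter_Ici hu a
      rw [hXeq a ha hat₀ t ht hat, ← mul_assoc]
      exact ((hderiv a ha t ⟨ht, hat⟩).mul_const hua ⟨ht, hat⟩ _).congr
        (hc.inter isClosed_Ici) hua fun s hs => hXeq a ha hat₀ s hs.1 hs.2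
    -- A base strictly below `t` makes the truncation harmless near `t`; if there is none, `t` is
    -- the minimum of `T` and nothing is truncated.
    by_cases h : ∃ s ∈ T, s < t
    · obtain ⟨s, hs, hst⟩ := h
      have hmin : min s t₀ ∈ T := by
        rcases min_choice s t₀ with h | h <;> rw [h] <;> assumption
      have hlt : min s t₀ < t := (min_le_left _ _).trans_lt hst
      exact (hlocal _ hmin (min_le_right _ _) hlt.le).of_inter_Ici hlt
    · push Not at h
      have h1 := hlocal t ht (h t₀ ht₀) le_rfl
      rwa [inter_eq_left.2 (show T ⊆ Ici t from fun s hs => h s hs)] at h1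
  · by_cases h : t₀ ≤ t
    · simp only [hX, if_pos h]
      exact hunit t₀ ht₀ t ht h
    · simp only [hX, if_neg h]
      exact (hunit t ht t₀ ht₀ (not_le.1 h).le).ringInverse

end Exponential

/-! ### Left limits along the forward jump -/

section LeftLimit

variable {T : Set ℝ}

theorem kappa_eq_self (hu : ¬ BddAbove T) : kappa T = T :=
  sep_eq_self_iff_mem_true.2 fun _ _ h => hu h.1.bddAbove

theorem eq_zero_of_comp_forwardJump_eq_zero {E : Type*} [TopologicalSpace E] [T2Space E] [Zero E]
    (hc : IsClosed T) (hu : ¬ BddAbove T) {w : ℝ → E} (hw : ContinuousOn w T) {s d : ℝ}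
    (hs : s ∈ T) (hcl : s ∈ closure (T ∩ Iio s)) (hds : d < s)
    (h : ∀ r ∈ T, d < r → r < s → w (forwardJump T r) = 0) : w s = 0 := by
  have hne : (𝓝[T ∩ Iio s] s).NeBot := mem_closure_iff_nhdsWithin_neBot.1 hcl
  have h1 : Tendsto (forwardJump T) (𝓝[T ∩ Iio s] s) (𝓝[T] s) :=
    tendsto_nhdsWithin_iff.2 ⟨tendsto_forwardJump_left hu hs,
      Eventually.of_forall fun r => forwardJump_mem hc hu r⟩
  refine tendsto_nhds_unique ((hw s hs).tendsto.comp h1) (tendsto_const_nhds.congr' ?_)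
  filter_upwards [self_mem_nhdsWithin, mem_nhdsWithin_of_mem_nhds (Ioi_mem_nhds hds)] with r hr hdr
  exact (h r hr.1 hdr hr.2).symm

theorem iterate_forwardJump_mem (hc : IsClosed T) (hu : ¬ BddAbove T) {a : ℝ} (ha : a ∈ T)
    (k : ℕ) : (forwardJump T)^[k] a ∈ T := by
  cases k with
  | zero => exact ha
  | succ k =>
    rw [Function.iterate_succ_apply']
    exact forwardJump_mem hc hu _

end LeftLimit

/-! ### Controllability matrix, Gramian and the two implications -/

section Kalman

open Matrix
open scoped Matrix.Norms.Operator

variable {n m : ℕ} {T : Set ℝ} {A : Matrix (Fin n) (Fin n) ℝ} {B : Matrix (Fin n) (Fin m) ℝ}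

theorem controllabilityMatrix_mulVec (A : Matrix (Fin n) (Fin n) ℝ) (B : Matrix (Fin n) (Fin m) ℝ)
    (v : Fin n × Fin m → ℝ) :
    controllabilityMatrix A B *ᵥ v =
      ∑ k : Fin n, (A ^ (k : ℕ) * B) *ᵥ fun j => v (k, j) := by
  ext i
  simp only [controllabilityMatrix, mulVec, dotProduct, of_apply, Fintype.sum_prod_type,
    Finset.sum_apply]

/-- Cayley–Hamilton: `A ^ k` is a combination of the powers below `n`, by reduction modulo the
characteristic polynomial. -/
theorem pow_mul_mulVec_mem_range_controllabilityMatrix (A : Matrix (Fin n) (Fin n) ℝ)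
    (B : Matrix (Fin n) (Fin m) ℝ) (k : ℕ) (u : Fin m → ℝ) :
    (A ^ k * B) *ᵥ u ∈ LinearMap.range (controllabilityMatrix A B).mulVecLin := by
  have hlt : ∀ k : Fin n, (A ^ (k : ℕ) * B) *ᵥ u ∈
      LinearMap.range (controllabilityMatrix A B).mulVecLin := by
    intro k
    refine ⟨fun kj => if kj.1 = k then u kj.2 else 0, ?_⟩
    rw [mulVecLin_apply, controllabilityMatrix_mulVec, Finset.sum_eq_single k]
    · simp
    · intro l _ hl
      simp only [if_neg hl]
      exact mulVec_zero _
    · simp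
  -- For `n = 0` the characteristic polynomial is `1`, and no remainder has degree below `n`.
  rcases Nat.eq_zero_or_pos n with rfl | hn
  · rw [Subsingleton.elim ((A ^ k * B) *ᵥ u) 0]
    exact Submodule.zero_mem _
  · have hdeg : A.charpoly.natDegree = n := by simp [charpoly_natDegree_eq_dim]
    have h1 : (Polynomial.X ^ k %ₘ A.charpoly).natDegree < n := by
      conv_rhs => rw [← hdeg]
      refine Polynomial.natDegree_modByMonic_lt _ A.charpoly_monic fun h => ?_
      rw [h, Polynomial.natDegree_one] at hdeg
      omega
    rw [pow_eq_aeval_mod_charpoly, Polynomial.aeval_eq_sum_range' h1, Matrix.sum_mul, sum_mulVec]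
    refine Submodule.sum_mem _ fun i hi => ?_
    rw [smul_mul, smul_mulVec]
    exact Submodule.smul_mem _ _ (hlt ⟨i, Finset.mem_range.1 hi⟩)

theorem mulVec_mem_range_controllabilityMatrix {w : Fin n → ℝ}
    (hw : w ∈ LinearMap.range (controllabilityMatrix A B).mulVecLin) :
    A *ᵥ w ∈ LinearMap.range (controllabilityMatrix A B).mulVecLin := by
  obtain ⟨v, rfl⟩ := hw
  rw [mulVecLin_apply, controllabilityMatrix_mulVec, mulVec_sum]
  refine Submodule.sum_mem _ fun k _ => ?_
  rw [mulVec_mulVec, ← Matrix.mul_assoc, ← pow_succ']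
  exact pow_mul_mulVec_mem_range_controllabilityMatrix A B _ _

theorem rank_controllabilityMatrix_eq_iff :
    (controllabilityMatrix A B).rank = n ↔
      LinearMap.range (controllabilityMatrix A B).mulVecLin = ⊤ := by
  constructor
  · intro h
    apply Submodule.eq_top_of_finrank_eq
    rw [Module.finrank_fin_fun]
    exact h
  · intro h
    rw [Matrix.rank, h, finrank_top, Module.finrank_fin_fun]

/-- By full rank `φ` is itself in the column space, to which it is orthogonal. -/
theorem eq_zero_of_vecMul_eq_zero (h : (controllabilityMatrix A B).rank = n) {φ : Fin n → ℝ}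
    (hφ : ∀ k < n, φ ᵥ* (A ^ k * B) = 0) : φ = 0 := by
  rw [rank_controllabilityMatrix_eq_iff, LinearMap.range_eq_top] at h
  obtain ⟨v, hv⟩ := h φ
  rw [mulVecLin_apply, controllabilityMatrix_mulVec] at hv
  apply dotProduct_self_eq_zero.1
  conv_lhs => rw [← hv, hv]
  nth_rewrite 2 [← hv]
  rw [dotProduct_sum]
  refine Finset.sum_eq_zero fun k _ => ?_
  rw [dotProduct_mulVec, hφ k k.2, zero_dotProduct]

theorem rank_eq_of_isControllableOn (hc : IsClosed T) (hu : ¬ BddAbove T) {p : ℕ}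
    (C : Matrix (Fin p) (Fin n) ℝ) (D : Matrix (Fin p) (Fin m) ℝ) {t₀ t_f : ℝ} (ht₀ : t₀ ∈ T)
    (ht_f : t_f ∈ T) (hle : t₀ ≤ t_f)
    (h : (LinearSystem.timeInvariant A B C D).IsControllableOn T t₀ t_f) :
    (controllabilityMatrix A B).rank = n := by
  rw [rank_controllabilityMatrix_eq_iff, eq_top_iff]
  rintro x_f -
  set W := LinearMap.range (controllabilityMatrix A B).mulVecLin with hW
  obtain ⟨W', hW'⟩ := W.exists_isCompl
  -- `P` projects onto a complement along `W`, hence has kernel `W`.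
  set P : (Fin n → ℝ) →ₗ[ℝ] (Fin n → ℝ) := W'.projection W hW'.symm with hP
  have hP0 : ∀ x, P x = 0 ↔ x ∈ W := fun x => Submodule.projection_apply_eq_zero_iff hW'.symm
  have hPP : ∀ x, P (P x) = P x := fun x =>
    Submodule.projection_apply_of_mem_left hW'.symm (Submodule.projection_apply_mem hW'.symm x)
  have hPA : ∀ x, P (A *ᵥ x) = P (A *ᵥ P x) := by
    intro x
    have h1 : x - P x ∈ W := by rw [← hP0, map_sub, hPP, sub_self]
    have h2 := (hP0 _).2 (mulVec_mem_range_controllabilityMatrix h1)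
    rw [mulVec_sub, map_sub, sub_eq_zero] at h2
    exact h2
  have hPB : ∀ u, P (B *ᵥ u) = 0 := by
    intro u
    have h1 := pow_mul_mulVec_mem_range_controllabilityMatrix A B 0 u
    rw [pow_zero, Matrix.one_mul] at h1
    exact (hP0 _).2 h1
  obtain ⟨u, -, x, y, hsol, hxf⟩ := h 0 x_f
  have hz := eq_zero_of_hasDeltaDerivAt_clm hc hu ht₀
    (LinearMap.toContinuousLinearMap (P ∘ₗ A.mulVecLin)) (z := fun t => P (x t))
    (fun t ht _ => by
      have h1 := (hsol.dynamics t (by rwa [kappa_eq_self hu])).clm_apply hu ht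
        (LinearMap.toContinuousLinearMap P)
      have h2 : P (A *ᵥ x t + B *ᵥ u t) = P (A *ᵥ P (x t)) := by
        rw [map_add, hPB, add_zero, hPA]
      simp only [LinearMap.coe_toContinuousLinearMap', LinearMap.comp_apply, mulVecLin_apply]
      rw [← h2]
      exact h1)
    (by simp [hsol.initial]) t_f ht_f hle
  rw [← hxf]
  exact (hP0 _).1 hz

/-- The derivative of `φᵀ M A^k B` at `r` is `-φᵀ M(σ(r)) A^(k+1) B`, so vanishing passes from `k`
to `k + 1`, but only at points `σ(r)`. A point that is no such jump is a limit from the left and is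
reached by continuity; this loses one jump at the left end. -/
theorem vecMul_eq_zero_of_adjoint (hc : IsClosed T) (hu : ¬ BddAbove T)
    {M : ℝ → Matrix (Fin n) (Fin n) ℝ}
    (hM : ∀ t ∈ T, HasDeltaDerivAt T M (-(M (forwardJump T t) * A)) t) {t₀ b : ℝ} (ht₀ : t₀ ∈ T)
    (hb : b ∈ T) (φ : Fin n → ℝ)
    (h0 : ∀ s ∈ T, t₀ ≤ s → s < b → φ ᵥ* (M (forwardJump T s) * B) = 0) (k : ℕ) :
    ∀ s ∈ T, (forwardJump T)^[k] t₀ < s → s ≤ b → φ ᵥ* (M s * (A ^ k * B)) = 0 := by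
  have hw : ∀ k : ℕ, ∀ t ∈ T, HasDeltaDerivAt T (fun t => φ ᵥ* (M t * (A ^ k * B)))
      (-(φ ᵥ* (M (forwardJump T t) * (A ^ (k + 1) * B)))) t := by
    intro k t ht
    let L : Matrix (Fin n) (Fin n) ℝ →ₗ[ℝ] (Fin m → ℝ) :=
      { toFun := fun N => φ ᵥ* (N * (A ^ k * B))
        map_add' := fun N N' => by rw [Matrix.add_mul, vecMul_add]
        map_smul' := fun c N => by rw [Matrix.smul_mul, vecMul_smul, RingHom.id_apply] }
    have h1 := (hM t ht).clm_apply hu ht (LinearMap.toContinuousLinearMap L)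
    have h2 : L (-(M (forwardJump T t) * A)) =
        -(φ ᵥ* (M (forwardJump T t) * (A ^ (k + 1) * B))) := by
      rw [map_neg, pow_succ', Matrix.mul_assoc A, ← Matrix.mul_assoc (M _) A]
      rfl
    rw [← h2]
    exact h1
  have hcont : ∀ k : ℕ, ContinuousOn (fun t => φ ᵥ* (M t * (A ^ k * B))) T := fun k t ht =>
    (hw k t ht).continuousWithinAt hu ht
  induction k with
  | zero =>
    intro s hs hts hsb
    rcases eq_forwardJump_or_mem_closure hc hu hs ⟨t₀, ht₀, hts⟩ with ⟨r, hr, hrs, rfl⟩ | hcl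
    · have htr : t₀ ≤ r := by
        by_contra h'
        push Not at h'
        exact absurd (forwardJump_le hu ht₀ h') (not_le.2 hts)
      simpa using h0 r hr htr (hrs.trans_le hsb)
    · refine eq_zero_of_comp_forwardJump_eq_zero hc hu (hcont 0) hs hcl hts fun r hr htr hrs => ?_
      simpa using h0 r hr (le_of_lt htr) (hrs.trans_le hsb)
  | succ k ih =>
    have hstep : ∀ r ∈ T, (forwardJump T)^[k] t₀ < r → r < b →
        φ ᵥ* (M (forwardJump T r) * (A ^ (k + 1) * B)) = 0 := by
      intro r hr hkr hrb
      refine neg_eq_zero.1 ((hw k r hr).eq_zero hc hu hr hb hrb fun s hs hrs hsb => ?_)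
      simp only [ih s hs (hkr.trans_le hrs) hsb, ih r hr hkr hrb.le]
    intro s hs hts hsb
    rw [Function.iterate_succ_apply'] at hts
    have hkT := iterate_forwardJump_mem hc hu ht₀ k
    have hks := (le_forwardJump hu ((forwardJump T)^[k] t₀)).trans_lt hts
    rcases eq_forwardJump_or_mem_closure hc hu hs ⟨_, hkT, hks⟩ with ⟨r, hr, hrs, rfl⟩ | hcl
    · refine hstep r hr ?_ (hrs.trans_le hsb)
      by_contra h'
      push Not at h'
      exact absurd (forwardJump_mono hu h') (not_le.2 hts)
    · exact eq_zero_of_comp_forwardJump_eq_zero hc hu (hcont (k + 1)) hs hcl hks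
        fun r hr hkr hrs => hstep r hr hkr (hrs.trans_le hsb)

/-- The integrand of the controllability Gramian. -/
def gramianIntegrand (B : Matrix (Fin n) (Fin m) ℝ) (M : ℝ → Matrix (Fin n) (Fin n) ℝ) (t : ℝ) :
    Matrix (Fin n) (Fin n) ℝ :=
  M t * B * (M t * B)ᵀ

theorem dotProduct_gramianIntegrand_mulVec (M : ℝ → Matrix (Fin n) (Fin n) ℝ) (t : ℝ)
    (φ : Fin n → ℝ) : φ ⬝ᵥ gramianIntegrand B M t *ᵥ φ =
      (φ ᵥ* (M t * B)) ⬝ᵥ (φ ᵥ* (M t * B)) := by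
  rw [gramianIntegrand, ← mulVec_mulVec, dotProduct_mulVec, mulVec_transpose]

theorem continuousOn_gramianIntegrand {M : ℝ → Matrix (Fin n) (Fin n) ℝ}
    (hM : ContinuousOn M T) : ContinuousOn (gramianIntegrand B M) T := by
  have h : Continuous fun N : Matrix (Fin n) (Fin n) ℝ => N * B * (N * B)ᵀ :=
    (continuous_id.matrix_mul continuous_const).matrix_mul
      (continuous_id.matrix_mul continuous_const).matrix_transpose
  exact h.comp_continuousOn hM

/-- The controllability Gramian `∫_{t₀}^t M(σ(s)) B Bᵀ M(σ(s))ᵀ Δs`. -/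
noncomputable def gramian (T : Set ℝ) (B : Matrix (Fin n) (Fin m) ℝ)
    (M : ℝ → Matrix (Fin n) (Fin n) ℝ) (t₀ t : ℝ) : Matrix (Fin n) (Fin n) ℝ :=
  ∫ r in t₀..t, gramianIntegrand B M (forwardJump T (lastPoint T r))

theorem hasDeltaDerivAt_gramian (hc : IsClosed T) (hu : ¬ BddAbove T)
    {M : ℝ → Matrix (Fin n) (Fin n) ℝ} (hM : ContinuousOn M T) (t₀ : ℝ) {t : ℝ} (ht : t ∈ T) :
    HasDeltaDerivAt T (gramian T B M t₀) (gramianIntegrand B M (forwardJump T t)) t :=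
  hasDeltaDerivAt_integral (f := fun t => gramianIntegrand B M (forwardJump T t)) hu
    (intervalIntegrable_comp_forwardJump hc hu ⟨t, ht⟩ (continuousOn_gramianIntegrand hM))
    (fun s hs hσ => (rdContinuous_comp_forwardJump hc hu (continuousOn_gramianIntegrand hM)).1 s hs
      ⟨nonempty_inter_Ioi hu s, hσ⟩) hc t₀ ht

/-- The function `t ↦ φᵀ G(t) φ` is nondecreasing and zero at both ends, so it is constant between;
its delta derivative `|φᵀ M(σ(t)) B|²` then vanishes. -/
theorem vecMul_eq_zero_of_gramian_mulVec_eq_zero (hc : IsClosed T) (hu : ¬ BddAbove T)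
    {M : ℝ → Matrix (Fin n) (Fin n) ℝ} (hM : ContinuousOn M T) {t₀ b : ℝ}
    (hb : b ∈ T) {φ : Fin n → ℝ} (h : gramian T B M t₀ b *ᵥ φ = 0) :
    ∀ s ∈ T, t₀ ≤ s → s < b → φ ᵥ* (M (forwardJump T s) * B) = 0 := by
  let Q : Matrix (Fin n) (Fin n) ℝ →ₗ[ℝ] ℝ :=
    { toFun := fun N => φ ⬝ᵥ N *ᵥ φ
      map_add' := fun N N' => by rw [add_mulVec, dotProduct_add]
      map_smul' := fun c N => by rw [smul_mulVec, dotProduct_smul, RingHom.id_apply] }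
  let L := LinearMap.toContinuousLinearMap Q
  have hint := fun a b => intervalIntegrable_comp_forwardJump hc hu ⟨_, hb⟩
    (continuousOn_gramianIntegrand (B := B) hM) a b
  have hL : ∀ t, L (gramianIntegrand B M t) = (φ ᵥ* (M t * B)) ⬝ᵥ (φ ᵥ* (M t * B)) :=
    fun t => dotProduct_gramianIntegrand_mulVec M t φ
  have hnonneg : ∀ t, 0 ≤ L (gramianIntegrand B M t) := by
    intro t
    rw [hL]
    exact Finset.sum_nonneg fun i _ => mul_self_nonneg _
  have hmono : ∀ s t, s ≤ t → L (gramian T B M t₀ s) ≤ L (gramian T B M t₀ t) := by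
    intro s t hst
    rw [← sub_nonneg, ← map_sub, gramian, gramian,
      intervalIntegral.integral_interval_sub_left (hint _ _) (hint _ _)]
    exact (intervalIntegral.integral_nonneg hst fun r _ => hnonneg _).trans_eq
      (L.intervalIntegral_comp_comm (hint s t))
  have hstart : L (gramian T B M t₀ t₀) = 0 := by
    rw [gramian, intervalIntegral.integral_same, map_zero]
  have hend : L (gramian T B M t₀ b) = 0 := by
    change φ ⬝ᵥ gramian T B M t₀ b *ᵥ φ = 0
    rw [h, dotProduct_zero]
  have hzero : ∀ s, t₀ ≤ s → s ≤ b → L (gramian T B M t₀ s) = 0 := fun s h1 h2 =>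
    le_antisymm ((hmono s b h2).trans_eq hend) (hstart.symm.trans_le (hmono t₀ s h1))
  intro s hs hts hsb
  have h1 := ((hasDeltaDerivAt_gramian (B := B) hc hu hM t₀ hs).clm_apply hu hs L).eq_zero hc hu hs
    hb hsb fun r _ hsr hrb => (hzero r (hts.trans hsr) hrb).trans (hzero s hts hsb.le).symm
  exact dotProduct_self_eq_zero.1 ((hL _).symm.trans h1)

theorem isControllableOn_of_rank_eq (hc : IsClosed T) (hu : ¬ BddAbove T) {p : ℕ}
    (C : Matrix (Fin p) (Fin n) ℝ) (D : Matrix (Fin p) (Fin m) ℝ)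
    (hreg : ∀ t ∈ T, IsUnit (1 + graininess T t • A)) {t₀ t_f : ℝ} (ht₀ : t₀ ∈ T)
    (ht_f : t_f ∈ T) (hcard : (n : ℕ∞) ≤ (T ∩ Ico t₀ t_f).encard)
    (hrank : (controllabilityMatrix A B).rank = n) :
    (LinearSystem.timeInvariant A B C D).IsControllableOn T t₀ t_f := by
  obtain ⟨Φ, hΦ₀, hΦ, hunit⟩ := exists_fundamental_solution hc hu ht₀ A hreg
  set M : ℝ → Matrix (Fin n) (Fin n) ℝ := fun t => Ring.inverse (Φ t) with hMdef
  have hMderiv : ∀ t ∈ T, HasDeltaDerivAt T M (-(M (forwardJump T t) * A)) t := by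
    intro t ht
    have h1 := (hΦ t ht).inverse hc hu ht hunit
    rwa [mul_assoc, mul_assoc, Ring.mul_inverse_cancel _ (hunit t ht), mul_one] at h1
  have hMcont : ContinuousOn M T := fun t ht => (hMderiv t ht).continuousWithinAt hu ht
  have hker : ∀ φ, gramian T B M t₀ t_f *ᵥ φ = 0 → φ = 0 := by
    intro φ hφ
    have h1 := vecMul_eq_zero_of_adjoint hc hu hMderiv ht₀ ht_f φ
      (vecMul_eq_zero_of_gramian_mulVec_eq_zero hc hu hMcont ht_f hφ)
    have h2 : φ ᵥ* M t_f = 0 := by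
      refine eq_zero_of_vecMul_eq_zero hrank fun k hk => ?_
      rw [vecMul_vecMul]
      exact h1 k t_f ht_f
        (iterate_forwardJump_lt hu k t₀ (lt_of_lt_of_le (by exact_mod_cast hk) hcard)) le_rfl
    have h3 : φ ᵥ* (M t_f * Φ t_f) = 0 := by
      rw [← vecMul_vecMul, h2, zero_vecMul]
    rwa [Ring.inverse_mul_cancel _ (hunit t_f ht_f), vecMul_one] at h3
  have hG : Function.Surjective (gramian T B M t₀ t_f).mulVec := by
    rw [mulVec_surjective_iff_isUnit, ← mulVec_injective_iff_isUnit]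
    intro v w hvw
    exact sub_eq_zero.1 (hker _ (by rw [mulVec_sub]; exact sub_eq_zero.2 hvw))
  intro x₀ x_f
  -- Solves `Φ(t_f)(x₀ + G φ) = x_f` for `φ`.
  obtain ⟨φ, hφ⟩ := hG (M t_f *ᵥ x_f - x₀)
  have hucont : ContinuousOn (fun t => (M t * B)ᵀ *ᵥ φ) T := by
    have h : Continuous fun N : Matrix (Fin n) (Fin n) ℝ => (N * B)ᵀ *ᵥ φ :=
      (continuous_id.matrix_mul continuous_const).matrix_transpose.matrix_mulVec continuous_const
    exact h.comp_continuousOn hMcont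
  refine ⟨fun t => (M (forwardJump T t) * B)ᵀ *ᵥ φ, rdContinuous_comp_forwardJump hc hu hucont,
    fun t => Φ t *ᵥ x₀ + (Φ t * gramian T B M t₀ t) *ᵥ φ, fun t =>
    C *ᵥ (Φ t *ᵥ x₀ + (Φ t * gramian T B M t₀ t) *ᵥ φ) +
      D *ᵥ ((M (forwardJump T t) * B)ᵀ *ᵥ φ), ⟨?_, ?_, fun t _ => rfl⟩, ?_⟩
  · intro t ht
    rw [kappa_eq_self hu] at ht
    let ev : (Fin n → ℝ) → Matrix (Fin n) (Fin n) ℝ →ₗ[ℝ] (Fin n → ℝ) := fun v =>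
      { toFun := fun N => N *ᵥ v
        map_add' := fun N N' => add_mulVec N N' v
        map_smul' := fun c N => smul_mulVec c N v }
    have h1 := (hΦ t ht).clm_apply hu ht (LinearMap.toContinuousLinearMap (ev x₀))
    have h2 := ((hΦ t ht).mul hu ht
      (hasDeltaDerivAt_gramian (B := B) hc hu hMcont t₀ ht)).clm_apply hu ht
      (LinearMap.toContinuousLinearMap (ev φ))
    have h3 : A *ᵥ (Φ t *ᵥ x₀ + (Φ t * gramian T B M t₀ t) *ᵥ φ) +
        B *ᵥ ((M (forwardJump T t) * B)ᵀ *ᵥ φ) = (A * Φ t) *ᵥ x₀ +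
        (A * Φ t * gramian T B M t₀ t + Φ (forwardJump T t) *
          gramianIntegrand B M (forwardJump T t)) *ᵥ φ := by
      rw [gramianIntegrand, ← Matrix.mul_assoc, ← Matrix.mul_assoc,
        Ring.mul_inverse_cancel _ (hunit _ (forwardJump_mem hc hu t)), Matrix.one_mul, add_mulVec,
        mulVec_add, mulVec_mulVec, mulVec_mulVec, mulVec_mulVec, Matrix.mul_assoc, add_assoc]
    change HasDeltaDerivAt T _ (A *ᵥ _ + B *ᵥ _) t
    rw [h3]
    exact h1.add hu ht h2
  · simp only [hΦ₀, gramian, intervalIntegral.integral_same]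
    simp
  · simp only [← mulVec_mulVec]
    rw [hφ, ← mulVec_add, add_sub_cancel, mulVec_mulVec,
      Ring.mul_inverse_cancel _ (hunit t_f ht_f), one_mulVec]

end Kalman

end TimeScale

/-- Kalman controllability rank condition on time scales. -/
theorem theorem2p7 {T : Set ℝ} (hT : IsTimeScale T) (hT_unbounded : ¬ BddAbove T)
    (hT_grain : TimeScale.HasBoundedGraininess T) {n m p : ℕ}
    (A : Matrix (Fin n) (Fin n) ℝ) (B : Matrix (Fin n) (Fin m) ℝ)
    (C : Matrix (Fin p) (Fin n) ℝ) (D : Matrix (Fin p) (Fin m) ℝ)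
    (hreg : (TimeScale.LinearSystem.timeInvariant A B C D).IsRegressive T)
    {t₀ t_f : ℝ} (ht₀ : t₀ ∈ T) (ht_f : t_f ∈ T) (hle : t₀ ≤ t_f) :
    ((n : ℕ∞) ≤ (T ∩ Set.Ico t₀ t_f).encard →
      ((TimeScale.LinearSystem.timeInvariant A B C D).IsControllableOn T t₀ t_f ↔
        (TimeScale.controllabilityMatrix A B).rank = n)) ∧
    ((TimeScale.LinearSystem.timeInvariant A B C D).IsControllableOn T t₀ t_f →
      (TimeScale.controllabilityMatrix A B).rank = n) := by
  have hnec := TimeScale.rank_eq_of_isControllableOn (A := A) (B := B) hT.2 hT_unbounded C D ht₀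
    ht_f hle
  refine ⟨fun hcard => ⟨hnec, fun hrank => ?_⟩, hnec⟩
  exact TimeScale.isControllableOn_of_rank_eq hT.2 hT_unbounded C D
    (fun t ht => hreg t (by rwa [TimeScale.kappa_eq_self hT_unbounded])) ht₀ ht_f hcard hrank
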